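/- Let $n,k\in\mathbb N$ and let $Ag=\{0,1,\dots,n\}$ be the set of agents. The language $\mathcal L_n$ consists of the formulas $$\varphi ::= p \mid \neg p \mid \varphi\lor\varphi \mid \varphi\land\varphi \mid \Box\varphi \mid \Diamond\varphi \mid [i]\varphi \mid \langle i\rangle\varphi \mid \otimes_i\varphi \mid \ominus_i\varphi ,$$ where $i\in Ag$ and $p$ ranges over a denumerable set $Var$ of propositional variables. A $\mathsf{DS}_n^k$-model $M=(W,\{R_{[i]}\}_{i\in Ag},\{I_{\otimes_i}\}_{i\in Ag},V)$ consists of a non-empty set $W$ of worlds, relations $R_{[i]}\subseteq W\times W$, sets $I_{\otimes_i}\subseteq W$ and a valuation $V:Var\to\mathcal P(W)$ such that 1. each $R_{[i]}$ is an equivalence relation; 2. for every family $(u_i)_{i\in Ag}$ of worlds, $\bigcap_{i\in Ag}\{v \mid (u_i,v)\in R_{[i]}\}\neq\emptyset$ (independence of agents); 3. if $k>0$, then for every $i\in Ag$ and all $w_0,\dots,w_k\in W$ there are $0\le m<j\le k$ with $(w_m,w_j)\in R_{[i]}$ (limited choice; for $k=0$ nothing is required); 4. each $I_{\otimes_i}$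 is non-empty; 5. if $w\in I_{\otimes_i}$ and $(w,v)\in R_{[i]}$, then $v\in I_{\otimes_i}$. Satisfaction $M,w\Vdash\varphi$ is defined as usual for $p$, $\neg p$, $\lor$ and $\land$; $\Box$ and $\Diamond$ quantify universally and existentially over all worlds, $[i]$ and $\langle i\rangle$ over the worlds $v$ with $(w,v)\in R_{[i]}$, and $\otimes_i$ and $\ominus_i$ over the worlds in $I_{\otimes_i}$. The deontic multi-agent STIT logic $\mathsf{DS}_n^k$ is the set of formulas of $\mathcal L_n$ that are satisfied at every world of every $\mathsf{DS}_n^k$-model. **Corollary (Decidability and FMP).** For all $n,k\in\mathbb N$, the logic $\mathsf{DS}_n^k$ is decidable (for a standard Gödel numbering of formulas, the set of codes of its members is recursive) and has the finite model property: every formula $\varphi\in\mathcal L_n$ with $\varphi\notin\mathsf{DS}_n^k$ is falsified at some world of a $\mathsf{DS}_n^k$-model with finitely many worlds. -/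

import Mathlib

universe u

namespace DeonticSTIT

/-- The agent labels `{0, 1, ..., n}`. -/
abbrev Ag (n : ℕ) : Type := Fin (n + 1)

/-- Formulas of the language `L_n`, in negation normal form; the propositional variables
`p_0, p_1, ...` are represented by their indices. -/
inductive Formula (n : ℕ) : Type
  | var (p : ℕ) : Formula n
  | negVar (p : ℕ) : Formula n
  | or (φ ψ : Formula n) : Formula n
  | and (φ ψ : Formula n) : Formula n
  | box (φ : Formula n) : Formula n
  | dia (φ : Formula n) : Formula n
  | stit (i : Ag n) (φ : Formula n) : Formula n
  | stitDual (i : Ag n) (φ : Formula n) : Formula n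
  | ought (i : Ag n) (φ : Formula n) : Formula n
  | permit (i : Ag n) (φ : Formula n) : Formula n

/-- `DS_n^k`-frames. The limited choice condition `choice_limit` is only imposed for `k > 0`. -/
structure Frame (n k : ℕ) : Type (u + 1) where
  /-- the worlds -/
  W : Type u
  nonempty : Nonempty W
  /-- the choice relation `R_[i]` of each agent -/
  R : Ag n → W → W → Prop
  /-- the set of deontically optimal worlds of each agent -/
  opt : Ag n → Set W
  equivalence : ∀ i, Equivalence (R i)
  independence : ∀ v : Ag n → W, (⋂ i, {x | R i (v i) x}).Nonempty
  choice_limit : 0 < k → ∀ (i : Ag n) (w : Fin (k + 1) → W), ∃ m j, m < j ∧ R i (w m) (w j)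
  opt_nonempty : ∀ i, (opt i).Nonempty
  opt_closed : ∀ i w v, w ∈ opt i → R i w v → v ∈ opt i

/-- `DS_n^k`-models: a frame with a valuation of the propositional variables. -/
structure Model (n k : ℕ) : Type (u + 1) extends Frame.{u} n k where
  V : ℕ → Set W

/-- Satisfaction `M, w ⊩ φ`. -/
def Model.Sat {n k : ℕ} (M : Model.{u} n k) : M.W → Formula n → Prop
  | w, .var p => w ∈ M.V p
  | w, .negVar p => w ∉ M.V p
  | w, .or φ ψ => M.Sat w φ ∨ M.Sat w ψ
  | w, .and φ ψ => M.Sat w φ ∧ M.Sat w ψ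
  | _, .box φ => ∀ x : M.W, M.Sat x φ
  | _, .dia φ => ∃ x : M.W, M.Sat x φ
  | w, .stit i φ => ∀ x, M.R i w x → M.Sat x φ
  | w, .stitDual i φ => ∃ x, M.R i w x ∧ M.Sat x φ
  | _, .ought i φ => ∀ x ∈ M.opt i, M.Sat x φ
  | _, .permit i φ => ∃ x ∈ M.opt i, M.Sat x φ

/-- The logic `DS_n^k`: the set of formulas satisfied at every world of every `DS_n^k`-model. -/
def DS (n k : ℕ) : Set (Formula n) :=
  {φ | ∀ (M : Model.{u} n k) (w : M.W), M.Sat w φ}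

/-- Goedel numbering of formulas. -/
def Formula.code {n : ℕ} : Formula n → ℕ
  | .var p => Nat.pair 0 p
  | .negVar p => Nat.pair 1 p
  | .or φ ψ => Nat.pair 2 (Nat.pair φ.code ψ.code)
  | .and φ ψ => Nat.pair 3 (Nat.pair φ.code ψ.code)
  | .box φ => Nat.pair 4 φ.code
  | .dia φ => Nat.pair 5 φ.code
  | .stit i φ => Nat.pair 6 (Nat.pair i.val φ.code)
  | .stitDual i φ => Nat.pair 7 (Nat.pair i.val φ.code)
  | .ought i φ => Nat.pair 8 (Nat.pair i.val φ.code)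
  | .permit i φ => Nat.pair 9 (Nat.pair i.val φ.code)

theorem Formula.code_injective {n : ℕ} : Function.Injective (Formula.code (n := n)) := by
  intro φ
  induction φ <;> intro ψ h <;> cases ψ <;>
    simp_all [Formula.code, Nat.pair_eq_pair, Fin.val_inj] <;> grind

/-- A set of formulas is decidable if the set of Goedel numbers of its members is a computable
(recursive) set of natural numbers. -/
def IsDecidable {n : ℕ} (L : Set (Formula n)) : Prop :=
  ComputablePred fun m : ℕ => ∃ φ ∈ L, φ.code = m

/-- The finite model property of `DS_n^k`: each formula outside the logic is falsified at some
world of a `DS_n^k`-model with finitely many worlds. -/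
def HasFiniteModelProperty (n k : ℕ) : Prop :=
  ∀ φ : Formula n, φ ∉ DS.{u} n k → ∃ M : Model.{u} n k, Finite M.W ∧ ∃ w : M.W, ¬ M.Sat w φ

end DeonticSTIT

/-! Both claims follow from filtration. Fix a formula with code `m`. Subformulas have codes at most
`m`, so it suffices to record, for each world of a falsifying model, which formulas with code at
most `m` hold there and for which agents it is optimal. Identifying worlds with equal records leaves
at most `2 ^ (m + n + 2)` worlds. Two records are related for agent `i` when they agree on
optimality for `i` and on all `[i]`- and `⟨i⟩`-formulas. This relation contains the image of
`R_[i]`, so independence and limited choice, which only assert that certain pairs are related,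
survive (`Model.hasCertificate`); closure of the optimal worlds holds by construction.

Conversely, a set of records meeting these conditions and the truth conditions is itself a finite
model (`IsCertificate.sat_model_iff`). Being such a set is a statement of bounded arithmetic, so
membership in the logic is primitive recursive. -/

namespace DeonticSTIT

/-! ### Primitive recursive predicates -/

section Primrec

variable {α : Type*} [Primcodable α]

theorem primrecPred_const (p : Prop) : PrimrecPred fun _ : α => p := by
  classical
  exact ⟨fun _ => Classical.dec p, Primrec.const _⟩

theorem primrecPred_imp {p q : α → Prop} (hp : PrimrecPred p) (hq : PrimrecPred q) :
    PrimrecPred fun a => p a → q a :=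
  (hp.not.or hq).of_eq fun _ => imp_iff_not_or.symm

theorem primrecPred_iff {p q : α → Prop} (hp : PrimrecPred p) (hq : PrimrecPred q) :
    PrimrecPred fun a => (p a ↔ q a) :=
  ((primrecPred_imp hp hq).and (primrecPred_imp hq hp)).of_eq fun _ => iff_def.symm

theorem primrecPred_forall_lt {p : α → ℕ → Prop} {f : α → ℕ}
    (hp : PrimrecPred fun q : α × ℕ => p q.1 q.2) (hf : Primrec f) :
    PrimrecPred fun a => ∀ x < f a, p a x :=
  (PrimrecRel.comp (PrimrecRel.forall_mem_list (R := fun (x : ℕ) (a : α) => p a x)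
    (hp.comp (Primrec.pair Primrec.snd Primrec.fst)))
    (Primrec.list_range.comp hf) Primrec.id).of_eq fun _ => by simp

theorem primrecPred_exists_lt {p : α → ℕ → Prop} {f : α → ℕ}
    (hp : PrimrecPred fun q : α × ℕ => p q.1 q.2) (hf : Primrec f) :
    PrimrecPred fun a => ∃ x < f a, p a x :=
  (PrimrecRel.comp (PrimrecRel.exists_mem_list (R := fun (x : ℕ) (a : α) => p a x)
    (hp.comp (Primrec.pair Primrec.snd Primrec.fst)))
    (Primrec.list_range.comp hf) Primrec.id).of_eq fun _ => by simp

theorem primrec_pow {f g : α → ℕ} (hf : Primrec f) (hg : Primrec g) :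
    Primrec fun a => f a ^ g a :=
  Primrec₂.comp (f := fun a b : ℕ => a ^ b) (Primrec₂.unpaired'.1 Nat.Primrec.pow) hf hg

theorem primrec_self : Primrec fun a : α => a := Primrec.id

theorem primrec_fst {β γ : Type*} [Primcodable β] [Primcodable γ] {f : α → β × γ}
    (hf : Primrec f) : Primrec fun a => (f a).1 :=
  Primrec.fst.comp hf

theorem primrec_snd {β γ : Type*} [Primcodable β] [Primcodable γ] {f : α → β × γ}
    (hf : Primrec f) : Primrec fun a => (f a).2 :=
  Primrec.snd.comp hf

theorem primrec_add {f g : α → ℕ} (hf : Primrec f) (hg : Primrec g) :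
    Primrec fun a => f a + g a :=
  Primrec.nat_add.comp hf hg

theorem primrec_pair {f g : α → ℕ} (hf : Primrec f) (hg : Primrec g) :
    Primrec fun a => Nat.pair (f a) (g a) :=
  Primrec₂.natPair.comp hf hg

theorem primrecPred_eq {f g : α → ℕ} (hf : Primrec f) (hg : Primrec g) :
    PrimrecPred fun a => f a = g a :=
  Primrec.eq.comp hf hg

theorem primrecPred_lt {f g : α → ℕ} (hf : Primrec f) (hg : Primrec g) :
    PrimrecPred fun a => f a < g a :=
  Primrec.nat_lt.comp hf hg

theorem primrec_digit {f g h : α → ℕ} (hf : Primrec f) (hg : Primrec g) (hh : Primrec h) :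
    Primrec fun a => f a / g a ^ h a % g a :=
  Primrec.nat_mod.comp (Primrec.nat_div.comp hf (primrec_pow hg hh)) hg

end Primrec

/-! ### Finite sets and tuples as numbers -/

/-- The `j`-th binary digit of `x` is `1`. -/
def Bit (x j : ℕ) : Prop := x / 2 ^ j % 2 = 1

/-- Comprehension below `N`. `P` need not be decidable, so satisfaction in an infinite model is
allowed. -/
theorem exists_bits (N : ℕ) (P : ℕ → Prop) : ∃ x < 2 ^ N, ∀ j < N, Bit x j ↔ P j := by
  classical
  refine ⟨Nat.ofBits fun j : Fin N => decide (P j), Nat.ofBits_lt_two_pow _, fun j hj => ?_⟩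
  have h := Nat.testBit_ofBits_lt (fun j : Fin N => decide (P j)) j hj
  rw [Nat.testBit_eq_decide_div_mod_eq] at h
  simpa [Bit] using h

/-- Base-`N` expansion turns a quantifier over tuples of worlds into one bounded numerical
quantifier. -/
theorem exists_digits {N r : ℕ} (f : Fin r → ℕ) (hf : ∀ i, f i < N) :
    ∃ g < N ^ r, ∀ i : Fin r, g / N ^ (i : ℕ) % N = f i := by
  let f' : Fin r → Fin N := fun i => ⟨f i, hf i⟩
  refine ⟨finFunctionFinEquiv f', (finFunctionFinEquiv f').isLt, fun i => ?_⟩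
  have h := congrFun (finFunctionFinEquiv.symm_apply_apply f') i
  exact congrArg Fin.val h

/-! ### Recognizing codes of formulas -/

/-- `j` is the code of a variable or its negation, or is composed of codes in the set coded
by `c`. -/
def CodeStep (n c j : ℕ) : Prop :=
  ∃ a < j + 1, j = Nat.pair 0 a ∨ j = Nat.pair 1 a ∨
    (Bit c a ∧ (j = Nat.pair 4 a ∨ j = Nat.pair 5 a ∨
      (∃ b < j + 1, Bit c b ∧ (j = Nat.pair 2 (Nat.pair a b) ∨ j = Nat.pair 3 (Nat.pair a b))) ∨
      (∃ i < n + 1, j = Nat.pair 6 (Nat.pair i a) ∨ j = Nat.pair 7 (Nat.pair i a) ∨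
        j = Nat.pair 8 (Nat.pair i a) ∨ j = Nat.pair 9 (Nat.pair i a))))

/-- `m` is the code of a formula, expressed with bounded quantifiers. -/
def IsCode (n m : ℕ) : Prop :=
  ∃ c < 2 ^ (m + 1), Bit c m ∧ ∀ j < m + 1, Bit c j → CodeStep n c j

/-- Positivity of the tag is essential: `Nat.pair 0 1 = 1`. All compound formulas have positive
tags, so decoding descends strictly. -/
theorem lt_pair_of_le {a b c : ℕ} (h : a ≤ b) (hc : 0 < c) : a < Nat.pair c b := by
  have := Nat.add_le_pair c b
  omega

theorem isCode_iff {n m : ℕ} : IsCode n m ↔ ∃ φ : Formula n, φ.code = m := by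
  constructor
  · rintro ⟨c, -, hm, hc⟩
    have key : ∀ j, j ≤ m → Bit c j → ∃ φ : Formula n, φ.code = j := by
      intro j
      induction j using Nat.strong_induction_on with
      | _ j ih =>
        intro hj hb
        obtain ⟨a, -, h | h | ⟨ha, h | h | ⟨b, -, hb', h | h⟩ | ⟨i, hi, h | h | h | h⟩⟩⟩ :=
          hc j (by omega) hb
        · exact ⟨.var a, h.symm⟩
        · exact ⟨.negVar a, h.symm⟩
        · have := lt_pair_of_le (le_refl a) (show 0 < 4 by norm_num)
          obtain ⟨φ, rfl⟩ := ih a (by omega) (by omega) ha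
          exact ⟨.box φ, h.symm⟩
        · have := lt_pair_of_le (le_refl a) (show 0 < 5 by norm_num)
          obtain ⟨φ, rfl⟩ := ih a (by omega) (by omega) ha
          exact ⟨.dia φ, h.symm⟩
        · have h1 := lt_pair_of_le (Nat.left_le_pair a b) (show 0 < 2 by norm_num)
          have h2 := lt_pair_of_le (Nat.right_le_pair a b) (show 0 < 2 by norm_num)
          obtain ⟨φ, rfl⟩ := ih a (by omega) (by omega) ha
          obtain ⟨ψ, rfl⟩ := ih b (by omega) (by omega) hb'
          exact ⟨.or φ ψ, h.symm⟩
        · have h1 := lt_pair_of_le (Nat.left_le_pair a b) (show 0 < 3 by norm_num)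
          have h2 := lt_pair_of_le (Nat.right_le_pair a b) (show 0 < 3 by norm_num)
          obtain ⟨φ, rfl⟩ := ih a (by omega) (by omega) ha
          obtain ⟨ψ, rfl⟩ := ih b (by omega) (by omega) hb'
          exact ⟨.and φ ψ, h.symm⟩
        · have := lt_pair_of_le (Nat.right_le_pair i a) (show 0 < 6 by norm_num)
          obtain ⟨φ, rfl⟩ := ih a (by omega) (by omega) ha
          exact ⟨.stit ⟨i, hi⟩ φ, h.symm⟩
        · have := lt_pair_of_le (Nat.right_le_pair i a) (show 0 < 7 by norm_num)
          obtain ⟨φ, rfl⟩ := ih a (by omega) (by omega) ha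
          exact ⟨.stitDual ⟨i, hi⟩ φ, h.symm⟩
        · have := lt_pair_of_le (Nat.right_le_pair i a) (show 0 < 8 by norm_num)
          obtain ⟨φ, rfl⟩ := ih a (by omega) (by omega) ha
          exact ⟨.ought ⟨i, hi⟩ φ, h.symm⟩
        · have := lt_pair_of_le (Nat.right_le_pair i a) (show 0 < 9 by norm_num)
          obtain ⟨φ, rfl⟩ := ih a (by omega) (by omega) ha
          exact ⟨.permit ⟨i, hi⟩ φ, h.symm⟩
    exact key m le_rfl hm
  · rintro ⟨χ, rfl⟩
    obtain ⟨c, hlt, hc⟩ := exists_bits (χ.code + 1) fun j => ∃ φ : Formula n, φ.code = j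
    -- The witness marks all formula codes up to `χ.code`, not only those of subformulas of `χ`.
    refine ⟨c, hlt, (hc _ (by omega)).2 ⟨χ, rfl⟩, fun j hj hb => ?_⟩
    obtain ⟨φ, rfl⟩ := (hc j hj).1 hb
    have hbit : ∀ ψ : Formula n, ψ.code < φ.code + 1 → Bit c ψ.code := fun ψ h =>
      (hc _ (by omega)).2 ⟨ψ, rfl⟩
    have hle : ∀ t b : ℕ, b < Nat.pair t b + 1 := fun t b =>
      Nat.lt_succ_of_le (Nat.right_le_pair t b)
    have hl : ∀ t a b : ℕ, a < Nat.pair t (Nat.pair a b) + 1 := fun t a b =>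
      Nat.lt_succ_of_le ((Nat.left_le_pair a b).trans (Nat.right_le_pair t _))
    have hr : ∀ t a b : ℕ, b < Nat.pair t (Nat.pair a b) + 1 := fun t a b =>
      Nat.lt_succ_of_le ((Nat.right_le_pair a b).trans (Nat.right_le_pair t _))
    cases φ with
    | var p => exact ⟨p, hle _ _, .inl rfl⟩
    | negVar p => exact ⟨p, hle _ _, .inr (.inl rfl)⟩
    | or φ ψ =>
      exact ⟨φ.code, hl _ _ _, .inr (.inr ⟨hbit _ (hl _ _ _), .inr (.inr (.inl
        ⟨ψ.code, hr _ _ _, hbit _ (hr _ _ _), .inl rfl⟩))⟩)⟩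
    | and φ ψ =>
      exact ⟨φ.code, hl _ _ _, .inr (.inr ⟨hbit _ (hl _ _ _), .inr (.inr (.inl
        ⟨ψ.code, hr _ _ _, hbit _ (hr _ _ _), .inr rfl⟩))⟩)⟩
    | box φ => exact ⟨φ.code, hle _ _, .inr (.inr ⟨hbit _ (hle _ _), .inl rfl⟩)⟩
    | dia φ => exact ⟨φ.code, hle _ _, .inr (.inr ⟨hbit _ (hle _ _), .inr (.inl rfl)⟩)⟩
    | stit i φ =>
      exact ⟨φ.code, hr _ _ _, .inr (.inr ⟨hbit _ (hr _ _ _), .inr (.inr (.inr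
        ⟨i, i.isLt, .inl rfl⟩))⟩)⟩
    | stitDual i φ =>
      exact ⟨φ.code, hr _ _ _, .inr (.inr ⟨hbit _ (hr _ _ _), .inr (.inr (.inr
        ⟨i, i.isLt, .inr (.inl rfl)⟩))⟩)⟩
    | ought i φ =>
      exact ⟨φ.code, hr _ _ _, .inr (.inr ⟨hbit _ (hr _ _ _), .inr (.inr (.inr
        ⟨i, i.isLt, .inr (.inr (.inl rfl))⟩))⟩)⟩
    | permit i φ =>
      exact ⟨φ.code, hr _ _ _, .inr (.inr ⟨hbit _ (hr _ _ _), .inr (.inr (.inr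
        ⟨i, i.isLt, .inr (.inr (.inr rfl))⟩))⟩)⟩

/-! ### Certificates of falsifiability

A world is coded by a number `x < 2 ^ (m + n + 2)`: for `j ≤ m` the digit `j` of `x` is the truth
value of the formula with code `j`, and the digit `m + 1 + i` tells whether the world is optimal
for the agent `i`. A set of worlds is coded by a number `s` whose digits select its elements. -/

/-- The strict bound on the codes of worlds. -/
def worldBound (n m : ℕ) : ℕ := 2 ^ (m + n + 2)

/-- The worlds coded by `x` and `y` are in the same choice cell of the agent `i`. -/
def SameCell (m i x y : ℕ) : Prop :=
  (Bit x (m + 1 + i) ↔ Bit y (m + 1 + i)) ∧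
  ∀ a < m + 1,
    (Nat.pair 6 (Nat.pair i a) < m + 1 →
      (Bit x (Nat.pair 6 (Nat.pair i a)) ↔ Bit y (Nat.pair 6 (Nat.pair i a)))) ∧
    (Nat.pair 7 (Nat.pair i a) < m + 1 →
      (Bit x (Nat.pair 7 (Nat.pair i a)) ↔ Bit y (Nat.pair 7 (Nat.pair i a))))

/-- Independence of agents for the worlds in `s`. -/
def IndependenceCond (n m s : ℕ) : Prop :=
  ∀ g < worldBound n m ^ (n + 1),
    (∀ i < n + 1, Bit s (g / worldBound n m ^ i % worldBound n m)) →
    ∃ x < worldBound n m, Bit s x ∧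
      ∀ i < n + 1, SameCell m i (g / worldBound n m ^ i % worldBound n m) x

/-- Limited choice for the worlds in `s`. -/
def ChoiceCond (n k m s : ℕ) : Prop :=
  0 < k → ∀ i < n + 1, ∀ g < worldBound n m ^ (k + 1),
    (∀ j < k + 1, Bit s (g / worldBound n m ^ j % worldBound n m)) →
    ∃ j < k + 1, ∃ l < j, SameCell m i (g / worldBound n m ^ l % worldBound n m)
      (g / worldBound n m ^ j % worldBound n m)

/-- Each agent has an optimal world in `s`. -/
def OptCond (n m s : ℕ) : Prop :=
  ∀ i < n + 1, ∃ x < worldBound n m, Bit s x ∧ Bit x (m + 1 + i)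

/-- The truth conditions of the connectives at the world `x` in `s`. -/
def TruthCond (n m s x : ℕ) : Prop :=
  ∀ a < m + 1,
    (Nat.pair 1 a < m + 1 → (Bit x (Nat.pair 1 a) ↔ ¬ Bit x (Nat.pair 0 a))) ∧
    (IsCode n a →
      (Nat.pair 4 a < m + 1 →
        (Bit x (Nat.pair 4 a) ↔ ∀ y < worldBound n m, Bit s y → Bit y a)) ∧
      (Nat.pair 5 a < m + 1 →
        (Bit x (Nat.pair 5 a) ↔ ∃ y < worldBound n m, Bit s y ∧ Bit y a)) ∧
      (∀ b < m + 1, IsCode n b →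
        (Nat.pair 2 (Nat.pair a b) < m + 1 →
          (Bit x (Nat.pair 2 (Nat.pair a b)) ↔ Bit x a ∨ Bit x b)) ∧
        (Nat.pair 3 (Nat.pair a b) < m + 1 →
          (Bit x (Nat.pair 3 (Nat.pair a b)) ↔ Bit x a ∧ Bit x b))) ∧
      (∀ i < n + 1,
        (Nat.pair 6 (Nat.pair i a) < m + 1 →
          (Bit x (Nat.pair 6 (Nat.pair i a)) ↔
            ∀ y < worldBound n m, Bit s y → SameCell m i x y → Bit y a)) ∧
        (Nat.pair 7 (Nat.pair i a) < m + 1 →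
          (Bit x (Nat.pair 7 (Nat.pair i a)) ↔
            ∃ y < worldBound n m, Bit s y ∧ SameCell m i x y ∧ Bit y a)) ∧
        (Nat.pair 8 (Nat.pair i a) < m + 1 →
          (Bit x (Nat.pair 8 (Nat.pair i a)) ↔
            ∀ y < worldBound n m, Bit s y → Bit y (m + 1 + i) → Bit y a)) ∧
        (Nat.pair 9 (Nat.pair i a) < m + 1 →
          (Bit x (Nat.pair 9 (Nat.pair i a)) ↔
            ∃ y < worldBound n m, Bit s y ∧ Bit y (m + 1 + i) ∧ Bit y a))))

/-- `s` codes a finite model with a world that falsifies the formula with code `m`. -/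
def IsCertificate (n k m s : ℕ) : Prop :=
  IndependenceCond n m s ∧ ChoiceCond n k m s ∧ OptCond n m s ∧
  (∀ x < worldBound n m, Bit s x → TruthCond n m s x) ∧
  ∃ x < worldBound n m, Bit s x ∧ ¬ Bit x m

/-- The formula with code `m` has a certificate of falsifiability. -/
def HasCertificate (n k m : ℕ) : Prop :=
  ∃ s < 2 ^ worldBound n m, IsCertificate n k m s

theorem primrecPred_bit {α : Type*} [Primcodable α] {f g : α → ℕ} (hf : Primrec f)
    (hg : Primrec g) : PrimrecPred fun a => Bit (f a) (g a) :=
  primrecPred_eq (primrec_digit hf (Primrec.const 2) hg) (Primrec.const 1)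

theorem primrecPred_isCode (n : ℕ) : PrimrecPred fun m => IsCode n m := by
  unfold IsCode CodeStep
  repeat' with_reducible first
    | exact Primrec.const _
    | exact primrec_self
    | apply primrecPred_bit
    | apply primrecPred_forall_lt
    | apply primrecPred_exists_lt
    | apply PrimrecPred.and
    | apply PrimrecPred.or
    | apply primrecPred_imp
    | apply primrecPred_eq
    | apply primrec_fst
    | apply primrec_snd
    | apply primrec_add
    | apply primrec_pair
    | apply primrec_pow

theorem primrecPred_hasCertificate (n k : ℕ) : PrimrecPred fun m => HasCertificate n k m := by
  have hcode : ∀ {α : Type} [Primcodable α] {f : α → ℕ}, Primrec f →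
      PrimrecPred fun a => IsCode n (f a) := fun hf => (primrecPred_isCode n).comp hf
  unfold HasCertificate IsCertificate IndependenceCond ChoiceCond OptCond TruthCond SameCell
    worldBound
  -- The search follows the syntax of the condition; reducible transparency keeps `Bit` and `IsCode`
  -- folded.
  repeat' with_reducible first
    | exact Primrec.const _
    | exact primrec_self
    | exact primrecPred_const _
    | apply primrecPred_bit
    | apply hcode
    | apply primrecPred_forall_lt
    | apply primrecPred_exists_lt
    | apply PrimrecPred.and
    | apply PrimrecPred.or
    | apply PrimrecPred.not
    | apply primrecPred_iff
    | apply primrecPred_lt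
    | apply primrecPred_imp
    | apply primrec_fst
    | apply primrec_snd
    | apply primrec_digit
    | apply primrec_add
    | apply primrec_pair
    | apply primrec_pow

/-! ### From certificates to finite models -/

theorem SameCell.refl (m i x : ℕ) : SameCell m i x x :=
  ⟨Iff.rfl, fun _ _ => ⟨fun _ => Iff.rfl, fun _ => Iff.rfl⟩⟩

theorem SameCell.symm {m i x y : ℕ} (h : SameCell m i x y) : SameCell m i y x :=
  ⟨h.1.symm, fun a ha => ⟨fun h' => ((h.2 a ha).1 h').symm, fun h' => ((h.2 a ha).2 h').symm⟩⟩

theorem SameCell.trans {m i x y z : ℕ} (h : SameCell m i x y) (h' : SameCell m i y z) :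
    SameCell m i x z :=
  ⟨h.1.trans h'.1, fun a ha => ⟨fun hp => ((h.2 a ha).1 hp).trans ((h'.2 a ha).1 hp),
    fun hp => ((h.2 a ha).2 hp).trans ((h'.2 a ha).2 hp)⟩⟩

/-- The worlds selected by `s`. -/
abbrev CodedWorld (n m s : ℕ) : Type u :=
  ULift.{u} {x : ℕ // x < worldBound n m ∧ Bit s x}

/-- The finite model coded by a certificate. -/
def IsCertificate.model {n k m s : ℕ} (h : IsCertificate n k m s) : Model.{u} n k where
  W := CodedWorld.{u} n m s
  nonempty := by
    obtain ⟨x, hx, hs, -⟩ := h.2.2.2.2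
    exact ⟨⟨x, hx, hs⟩⟩
  R i x y := SameCell m i x.down y.down
  opt i := {x | Bit x.down (m + 1 + i)}
  equivalence i := ⟨fun _ => SameCell.refl _ _ _, SameCell.symm, SameCell.trans⟩
  independence v := by
    obtain ⟨g, hg, hv⟩ := exists_digits (fun i => (v i).down.1) fun i => (v i).down.2.1
    obtain ⟨x, hx, hs, hcell⟩ := h.1 g hg fun i hi => by
      rw [hv ⟨i, hi⟩]
      exact (v ⟨i, hi⟩).down.2.2
    refine ⟨⟨x, hx, hs⟩, Set.mem_iInter.2 fun i => ?_⟩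
    have := hcell i i.isLt
    rw [hv i] at this
    exact this
  choice_limit hk i w := by
    obtain ⟨g, hg, hw⟩ := exists_digits (fun j => (w j).down.1) fun j => (w j).down.2.1
    obtain ⟨j, hj, l, hl, hcell⟩ := h.2.1 hk i i.isLt g hg fun j hj => by
      rw [hw ⟨j, hj⟩]
      exact (w ⟨j, hj⟩).down.2.2
    refine ⟨⟨l, hl.trans hj⟩, ⟨j, hj⟩, hl, ?_⟩
    rw [hw ⟨l, hl.trans hj⟩, hw ⟨j, hj⟩] at hcell
    exact hcell
  opt_nonempty i := by
    obtain ⟨x, hx, hs, ho⟩ := h.2.2.1 i i.isLt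
    exact ⟨⟨x, hx, hs⟩, ho⟩
  -- `SameCell` includes the optimality digit for exactly this purpose.
  opt_closed _ _ _ hw hR := hR.1.1 hw
  V p := {x | Bit x.down (Nat.pair 0 p)}

instance (n m s : ℕ) : Finite (CodedWorld.{u} n m s) :=
  have : Finite {x : ℕ // x < worldBound n m ∧ Bit s x} :=
    Set.Finite.subset (Set.finite_Iio (worldBound n m)) fun _ hx => hx.1
  inferInstance

theorem pair_le_pair_left {a b c : ℕ} (h : a ≤ b) : Nat.pair a c ≤ Nat.pair b c := by
  obtain h | rfl := h.lt_or_eq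
  · exact (Nat.pair_lt_pair_left c h).le
  · exact le_rfl

/-- Truth in the model of a certificate is given by the digits of the worlds. -/
theorem IsCertificate.sat_model_iff {n k m s : ℕ} (h : IsCertificate n k m s) (φ : Formula n)
    (hφ : φ.code < m + 1) (x : CodedWorld.{u} n m s) :
    h.model.Sat x φ ↔ Bit x.down φ.code := by
  have htruth : ∀ x : CodedWorld.{u} n m s, TruthCond n m s x.down := fun x =>
    h.2.2.2.1 _ x.down.2.1 x.down.2.2
  have hle : ∀ t b : ℕ, b ≤ Nat.pair t b := Nat.right_le_pair
  have hl : ∀ t a b : ℕ, a ≤ Nat.pair t (Nat.pair a b) := fun t a b =>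
    (Nat.left_le_pair a b).trans (Nat.right_le_pair t _)
  have hr : ∀ t a b : ℕ, b ≤ Nat.pair t (Nat.pair a b) := fun t a b =>
    (Nat.right_le_pair a b).trans (Nat.right_le_pair t _)
  have hcode : ∀ ψ : Formula n, IsCode n ψ.code := fun ψ => isCode_iff.2 ⟨ψ, rfl⟩
  induction φ generalizing x with
  | var p => exact Iff.rfl
  | negVar p => exact ((htruth x p ((hle _ _).trans_lt hφ)).1 hφ).symm
  | or φ ψ ihφ ihψ =>
    have h1 := (hl _ _ _).trans_lt hφ
    have h2 := (hr _ _ _).trans_lt hφ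
    exact (or_congr (ihφ h1 x) (ihψ h2 x)).trans
      ((((htruth x _ h1).2 (hcode φ)).2.2.1 _ h2 (hcode ψ)).1 hφ).symm
  | and φ ψ ihφ ihψ =>
    have h1 := (hl _ _ _).trans_lt hφ
    have h2 := (hr _ _ _).trans_lt hφ
    exact (and_congr (ihφ h1 x) (ihψ h2 x)).trans
      ((((htruth x _ h1).2 (hcode φ)).2.2.1 _ h2 (hcode ψ)).2 hφ).symm
  | box φ ih =>
    have h1 := (hle _ _).trans_lt hφ
    refine Iff.trans ?_ (((htruth x _ h1).2 (hcode φ)).1 hφ).symm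
    exact ⟨fun H y hy hs => (ih h1 ⟨y, hy, hs⟩).1 (H _),
      fun H y => (ih h1 y).2 (H _ y.down.2.1 y.down.2.2)⟩
  | dia φ ih =>
    have h1 := (hle _ _).trans_lt hφ
    refine Iff.trans ?_ (((htruth x _ h1).2 (hcode φ)).2.1 hφ).symm
    exact ⟨fun ⟨y, H⟩ => ⟨y.down, y.down.2.1, y.down.2.2, (ih h1 y).1 H⟩,
      fun ⟨y, hy, hs, H⟩ => ⟨⟨y, hy, hs⟩, (ih h1 _).2 H⟩⟩
  | stit i φ ih =>
    have h1 := (hr _ _ _).trans_lt hφ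
    refine Iff.trans ?_ ((((htruth x _ h1).2 (hcode φ)).2.2.2 i i.isLt).1 hφ).symm
    exact ⟨fun H y hy hs hR => (ih h1 ⟨y, hy, hs⟩).1 (H _ hR),
      fun H y hR => (ih h1 y).2 (H _ y.down.2.1 y.down.2.2 hR)⟩
  | stitDual i φ ih =>
    have h1 := (hr _ _ _).trans_lt hφ
    refine Iff.trans ?_ ((((htruth x _ h1).2 (hcode φ)).2.2.2 i i.isLt).2.1 hφ).symm
    exact ⟨fun ⟨y, hR, H⟩ => ⟨y.down, y.down.2.1, y.down.2.2, hR, (ih h1 y).1 H⟩,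
      fun ⟨y, hy, hs, hR, H⟩ => ⟨⟨y, hy, hs⟩, hR, (ih h1 _).2 H⟩⟩
  | ought i φ ih =>
    have h1 := (hr _ _ _).trans_lt hφ
    refine Iff.trans ?_ ((((htruth x _ h1).2 (hcode φ)).2.2.2 i i.isLt).2.2.1 hφ).symm
    exact ⟨fun H y hy hs ho => (ih h1 ⟨y, hy, hs⟩).1 (H _ ho),
      fun H y ho => (ih h1 y).2 (H _ y.down.2.1 y.down.2.2 ho)⟩
  | permit i φ ih =>
    have h1 := (hr _ _ _).trans_lt hφ
    refine Iff.trans ?_ ((((htruth x _ h1).2 (hcode φ)).2.2.2 i i.isLt).2.2.2 hφ).symm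
    exact ⟨fun ⟨y, ho, H⟩ => ⟨y.down, y.down.2.1, y.down.2.2, ho, (ih h1 y).1 H⟩,
      fun ⟨y, hy, hs, ho, H⟩ => ⟨⟨y, hy, hs⟩, ho, (ih h1 _).2 H⟩⟩

theorem HasCertificate.exists_finite_model {n k : ℕ} {φ : Formula n}
    (h : HasCertificate n k φ.code) :
    ∃ M : Model.{u} n k, Finite M.W ∧ ∃ w : M.W, ¬ M.Sat w φ := by
  obtain ⟨s, -, hs⟩ := h
  obtain ⟨x, hx, hsx, hφ⟩ := hs.2.2.2.2
  exact ⟨hs.model, inferInstanceAs (Finite (CodedWorld.{u} n φ.code s)), ⟨x, hx, hsx⟩,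
    fun H => hφ ((hs.sat_model_iff φ (Nat.lt_succ_self _) _).1 H)⟩

/-! ### From models to certificates: filtration -/

/-- `x` is the code of the world `w`, relative to the formulas with codes at most `m`. -/
def Model.Codes {n k : ℕ} (M : Model.{u} n k) (m : ℕ) (w : M.W) (x : ℕ) : Prop :=
  x < worldBound n m ∧
  (∀ j < m + 1, Bit x j ↔ ∃ φ : Formula n, φ.code = j ∧ M.Sat w φ) ∧
  ∀ i : Ag n, Bit x (m + 1 + i) ↔ w ∈ M.opt i

theorem Model.exists_codes {n k : ℕ} (M : Model.{u} n k) (m : ℕ) (w : M.W) :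
    ∃ x, M.Codes m w x := by
  -- There are `m + 1` truth digits followed by `n + 1` optimality digits; the two blocks are
  -- disjoint.
  obtain ⟨x, hx, hbit⟩ := exists_bits (m + n + 2) fun j =>
    (j < m + 1 ∧ ∃ φ : Formula n, φ.code = j ∧ M.Sat w φ) ∨
      ∃ i : Ag n, j = m + 1 + i ∧ w ∈ M.opt i
  refine ⟨x, hx, fun j hj => (hbit j (by omega)).trans ?_, fun i => (hbit _ ?_).trans ?_⟩
  · constructor
    · rintro (h | ⟨i, rfl, -⟩)
      · exact h.2
      · omega
    · exact fun h => .inl ⟨hj, h⟩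
  · have := i.isLt
    omega
  · constructor
    · rintro (h | ⟨i', h, hi'⟩)
      · omega
      · obtain rfl : i = i' := Fin.ext (by omega)
        exact hi'
    · exact fun h => .inr ⟨i, rfl, h⟩

theorem Model.Codes.bit_iff {n k m x : ℕ} {M : Model.{u} n k} {w : M.W} (h : M.Codes m w x)
    {φ : Formula n} (hφ : φ.code < m + 1) : Bit x φ.code ↔ M.Sat w φ := by
  refine (h.2.1 _ hφ).trans ⟨?_, fun H => ⟨φ, rfl, H⟩⟩
  rintro ⟨ψ, hψ, H⟩
  exact Formula.code_injective hψ ▸ H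

theorem Model.R_iff_of_R {n k : ℕ} (M : Model.{u} n k) {i : Ag n} {w v : M.W} (h : M.R i w v)
    (x : M.W) : M.R i w x ↔ M.R i v x :=
  ⟨(M.equivalence i).trans ((M.equivalence i).symm h), (M.equivalence i).trans h⟩

theorem Model.opt_iff_of_R {n k : ℕ} (M : Model.{u} n k) {i : Ag n} {w v : M.W}
    (h : M.R i w v) : w ∈ M.opt i ↔ v ∈ M.opt i :=
  ⟨fun hw => M.opt_closed i w v hw h, fun hv => M.opt_closed i v w hv ((M.equivalence i).symm h)⟩

/-- `SameCell` compares digits at every position of this shape, even if `a` codes no formula; a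
formula found there must begin with `[i]`. -/
theorem exists_eq_stit {n i a : ℕ} {φ : Formula n} (h : φ.code = Nat.pair 6 (Nat.pair i a)) :
    ∃ (i' : Ag n) (ψ : Formula n), i'.val = i ∧ φ = .stit i' ψ := by
  cases φ <;> simp_all [Formula.code, Nat.pair_eq_pair]

theorem exists_eq_stitDual {n i a : ℕ} {φ : Formula n}
    (h : φ.code = Nat.pair 7 (Nat.pair i a)) :
    ∃ (i' : Ag n) (ψ : Formula n), i'.val = i ∧ φ = .stitDual i' ψ := by
  cases φ <;> simp_all [Formula.code, Nat.pair_eq_pair]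

/-- The first filtration condition: optimality for `i` and the truth of `[i]`- and `⟨i⟩`-formulas
are constant on `R_[i]`-classes. -/
theorem Model.Codes.sameCell {n k m x y : ℕ} {M : Model.{u} n k} {w v : M.W} {i : Ag n}
    (hx : M.Codes m w x) (hy : M.Codes m v y) (h : M.R i w v) : SameCell m i x y := by
  refine ⟨(hx.2.2 i).trans ((M.opt_iff_of_R h).trans (hy.2.2 i).symm), fun a _ =>
    ⟨fun ha => (hx.2.1 _ ha).trans (Iff.trans ?_ (hy.2.1 _ ha).symm),
      fun ha => (hx.2.1 _ ha).trans (Iff.trans ?_ (hy.2.1 _ ha).symm)⟩⟩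
  · refine exists_congr fun φ => and_congr_right fun hφ => ?_
    obtain ⟨i', ψ, hi, rfl⟩ := exists_eq_stit hφ
    obtain rfl := Fin.ext hi
    exact forall_congr' fun z => imp_congr_left (M.R_iff_of_R h z)
  · refine exists_congr fun φ => and_congr_right fun hφ => ?_
    obtain ⟨i', ψ, hi, rfl⟩ := exists_eq_stitDual hφ
    obtain rfl := Fin.ext hi
    exact exists_congr fun z => and_congr_left' (M.R_iff_of_R h z)

/-- The second filtration condition: the digit of `[i]φ` passes from `x` to `y`, and reflexivity of
`R_[i]` at `v` then gives `φ`. -/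
theorem Model.Codes.sat_of_stit {n k m x y : ℕ} {M : Model.{u} n k} {w v : M.W} {i : Ag n}
    {φ : Formula n} (hφ : (Formula.stit i φ).code < m + 1) (hx : M.Codes m w x)
    (hy : M.Codes m v y) (h : SameCell m i x y) (hw : M.Sat w (.stit i φ)) : M.Sat v φ := by
  have ha : φ.code < m + 1 :=
    ((Nat.right_le_pair i φ.code).trans (Nat.right_le_pair 6 _)).trans_lt hφ
  exact (hy.bit_iff hφ).1 (((h.2 _ ha).1 hφ).1 ((hx.bit_iff hφ).2 hw)) v
    ((M.equivalence i).refl v)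

theorem Model.Codes.stitDual_of_sat {n k m x y : ℕ} {M : Model.{u} n k} {w v : M.W} {i : Ag n}
    {φ : Formula n} (hφ : (Formula.stitDual i φ).code < m + 1) (hx : M.Codes m w x)
    (hy : M.Codes m v y) (h : SameCell m i x y) (hv : M.Sat v φ) :
    M.Sat w (.stitDual i φ) := by
  have ha : φ.code < m + 1 :=
    ((Nat.right_le_pair i φ.code).trans (Nat.right_le_pair 7 _)).trans_lt hφ
  exact (hx.bit_iff hφ).1 (((h.2 _ ha).2 hφ).2 ((hy.bit_iff hφ).2
    ⟨v, (M.equivalence i).refl v, hv⟩))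

theorem Model.Codes.truthCond {n k m s : ℕ} {M : Model.{u} n k}
    (hs : ∀ x < worldBound n m, Bit s x ↔ ∃ w, M.Codes m w x) {w : M.W} {x : ℕ}
    (hx : M.Codes m w x) : TruthCond n m s x := by
  have hworld : ∀ v : M.W, ∃ y < worldBound n m, Bit s y ∧ M.Codes m v y := fun v => by
    obtain ⟨y, hy⟩ := M.exists_codes m v
    exact ⟨y, hy.1, (hs y hy.1).2 ⟨v, hy⟩, hy⟩
  refine fun a ha => ⟨fun h1 => ?_, fun hca => ?_⟩
  -- The digit of the variable is also recorded, since its code does not exceed that of its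
  -- negation.
  · exact (hx.bit_iff (φ := .negVar a) h1).trans (not_congr (hx.bit_iff (φ := .var a)
      ((pair_le_pair_left (Nat.zero_le 1)).trans_lt h1)).symm)
  obtain ⟨φ, rfl⟩ := isCode_iff.1 hca
  refine ⟨fun h4 => ?_, fun h5 => ?_, fun b hb hcb => ?_, fun i hi =>
    ⟨fun h6 => ?_, fun h7 => ?_, fun h8 => ?_, fun h9 => ?_⟩⟩
  · refine (hx.bit_iff (φ := .box φ) h4).trans ⟨fun H y hy hsy => ?_, fun H v => ?_⟩
    · obtain ⟨v, hv⟩ := (hs y hy).1 hsy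
      exact (hv.bit_iff ha).2 (H v)
    · obtain ⟨y, hy, hsy, hv⟩ := hworld v
      exact (hv.bit_iff ha).1 (H y hy hsy)
  · refine (hx.bit_iff (φ := .dia φ) h5).trans ⟨fun ⟨v, H⟩ => ?_, fun ⟨y, hy, hsy, H⟩ => ?_⟩
    · obtain ⟨y, hy, hsy, hv⟩ := hworld v
      exact ⟨y, hy, hsy, (hv.bit_iff ha).2 H⟩
    · obtain ⟨v, hv⟩ := (hs y hy).1 hsy
      exact ⟨v, (hv.bit_iff ha).1 H⟩
  · obtain ⟨ψ, rfl⟩ := isCode_iff.1 hcb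
    exact ⟨fun h2 => (hx.bit_iff (φ := .or φ ψ) h2).trans
        (or_congr (hx.bit_iff ha).symm (hx.bit_iff hb).symm),
      fun h3 => (hx.bit_iff (φ := .and φ ψ) h3).trans
        (and_congr (hx.bit_iff ha).symm (hx.bit_iff hb).symm)⟩
  · refine (hx.bit_iff (φ := .stit ⟨i, hi⟩ φ) h6).trans
      ⟨fun H y hy hsy hc => ?_, fun H v hR => ?_⟩
    · obtain ⟨v, hv⟩ := (hs y hy).1 hsy
      exact (hv.bit_iff ha).2 (hx.sat_of_stit (i := ⟨i, hi⟩) h6 hv hc H)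
    · obtain ⟨y, hy, hsy, hv⟩ := hworld v
      exact (hv.bit_iff ha).1 (H y hy hsy (hx.sameCell hv hR))
  · refine (hx.bit_iff (φ := .stitDual ⟨i, hi⟩ φ) h7).trans
      ⟨fun ⟨v, hR, H⟩ => ?_, fun ⟨y, hy, hsy, hc, H⟩ => ?_⟩
    · obtain ⟨y, hy, hsy, hv⟩ := hworld v
      exact ⟨y, hy, hsy, hx.sameCell hv hR, (hv.bit_iff ha).2 H⟩
    · obtain ⟨v, hv⟩ := (hs y hy).1 hsy
      exact hx.stitDual_of_sat (i := ⟨i, hi⟩) h7 hv hc ((hv.bit_iff ha).1 H)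
  · refine (hx.bit_iff (φ := .ought ⟨i, hi⟩ φ) h8).trans
      ⟨fun H y hy hsy ho => ?_, fun H v ho => ?_⟩
    · obtain ⟨v, hv⟩ := (hs y hy).1 hsy
      exact (hv.bit_iff ha).2 (H v ((hv.2.2 ⟨i, hi⟩).1 ho))
    · obtain ⟨y, hy, hsy, hv⟩ := hworld v
      exact (hv.bit_iff ha).1 (H y hy hsy ((hv.2.2 ⟨i, hi⟩).2 ho))
  · refine (hx.bit_iff (φ := .permit ⟨i, hi⟩ φ) h9).trans
      ⟨fun ⟨v, ho, H⟩ => ?_, fun ⟨y, hy, hsy, ho, H⟩ => ?_⟩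
    · obtain ⟨y, hy, hsy, hv⟩ := hworld v
      exact ⟨y, hy, hsy, (hv.2.2 ⟨i, hi⟩).2 ho, (hv.bit_iff ha).2 H⟩
    · obtain ⟨v, hv⟩ := (hs y hy).1 hsy
      exact ⟨v, (hv.2.2 ⟨i, hi⟩).1 ho, (hv.bit_iff ha).1 H⟩

theorem Model.hasCertificate {n k : ℕ} (M : Model.{u} n k) {w : M.W} {φ : Formula n}
    (hφ : ¬ M.Sat w φ) : HasCertificate n k φ.code := by
  set m := φ.code with hm
  -- `s` is exactly the image of `M`: each selected record has a world behind it, where the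
  -- conditions can be checked.
  obtain ⟨s, hlt, hs⟩ := exists_bits (worldBound n m) fun x => ∃ w, M.Codes m w x
  have hpos : 0 < worldBound n m := Nat.two_pow_pos _
  have hworld : ∀ v : M.W, ∃ y < worldBound n m, Bit s y ∧ M.Codes m v y := fun v => by
    obtain ⟨y, hy⟩ := M.exists_codes m v
    exact ⟨y, hy.1, (hs y hy.1).2 ⟨v, hy⟩, hy⟩
  refine ⟨s, hlt, fun g _ hg => ?_, fun hk i hi g _ hg => ?_, fun i hi => ?_,
    fun x hx hsx => ?_, ?_⟩
  · have hu : ∀ i : Ag n, ∃ v, M.Codes m v (g / worldBound n m ^ (i : ℕ) % worldBound n m) :=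
      fun i => (hs _ (Nat.mod_lt _ hpos)).1 (hg i i.isLt)
    choose u hu using hu
    obtain ⟨v, hv⟩ := M.independence u
    obtain ⟨y, hy, hsy, hvy⟩ := hworld v
    exact ⟨y, hy, hsy, fun i hi =>
      (hu ⟨i, hi⟩).sameCell hvy (Set.mem_iInter.1 hv ⟨i, hi⟩)⟩
  · have hu : ∀ j : Fin (k + 1), ∃ v,
        M.Codes m v (g / worldBound n m ^ (j : ℕ) % worldBound n m) :=
      fun j => (hs _ (Nat.mod_lt _ hpos)).1 (hg j j.isLt)
    choose u hu using hu
    obtain ⟨l, j, hlj, hR⟩ := M.choice_limit hk ⟨i, hi⟩ u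
    exact ⟨j, j.isLt, l, hlj, (hu l).sameCell (hu j) hR⟩
  · obtain ⟨v, hv⟩ := M.opt_nonempty ⟨i, hi⟩
    obtain ⟨y, hy, hsy, hvy⟩ := hworld v
    exact ⟨y, hy, hsy, (hvy.2.2 ⟨i, hi⟩).2 hv⟩
  · obtain ⟨v, hv⟩ := (hs x hx).1 hsx
    exact hv.truthCond hs
  · obtain ⟨y, hy, hsy, hwy⟩ := hworld w
    exact ⟨y, hy, hsy, fun H => hφ ((hwy.bit_iff (Nat.lt_succ_self _)).1 H)⟩

/-! ### Finite model property and decidability -/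

theorem hasCertificate_of_notMem_DS {n k : ℕ} {φ : Formula n} (h : φ ∉ DS.{u} n k) :
    HasCertificate n k φ.code := by
  simp only [DS, Set.mem_ofPred_eq, not_forall] at h
  obtain ⟨M, w, hw⟩ := h
  exact M.hasCertificate hw

/-- The right side mentions no universe, so the logic is the same for models in every universe. -/
theorem mem_DS_iff {n k : ℕ} {φ : Formula n} :
    φ ∈ DS.{u} n k ↔ ¬ HasCertificate n k φ.code := by
  refine ⟨fun h hc => ?_, fun h => by_contra fun h' => h (hasCertificate_of_notMem_DS h')⟩
  obtain ⟨M, -, w, hw⟩ := hc.exists_finite_model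
  exact hw (h M w)

theorem hasFiniteModelProperty (n k : ℕ) : HasFiniteModelProperty.{u} n k :=
  fun _ hφ => (hasCertificate_of_notMem_DS hφ).exists_finite_model

theorem isDecidable_DS (n k : ℕ) : IsDecidable (DS.{u} n k) := by
  have h : PrimrecPred fun m : ℕ => ∃ φ ∈ DS.{u} n k, φ.code = m := by
    refine ((primrecPred_isCode n).and (primrecPred_hasCertificate n k).not).of_eq fun m => ?_
    constructor
    · rintro ⟨hm, hc⟩
      obtain ⟨φ, rfl⟩ := isCode_iff.1 hm
      exact ⟨φ, mem_DS_iff.2 hc, rfl⟩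
    · rintro ⟨φ, hφ, rfl⟩
      exact ⟨isCode_iff.2 ⟨φ, rfl⟩, mem_DS_iff.1 hφ⟩
  obtain ⟨hdec, hprim⟩ := h
  exact ⟨hdec, hprim.to_comp⟩

end DeonticSTIT

theorem mainTheorem3 (n k : ℕ) :
    DeonticSTIT.IsDecidable (DeonticSTIT.DS.{u} n k) ∧
      DeonticSTIT.HasFiniteModelProperty.{u} n k :=
  ⟨DeonticSTIT.isDecidable_DS n k, DeonticSTIT.hasFiniteModelProperty n k⟩
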